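/- Let $\mathbb G$ be a Carnot group of step $s$ and dimension $N\ge 1$, i.e. a simply connected Lie group whose Lie algebra of left invariant vector fields splits as $\mathfrak g=V_1\oplus\dots\oplus V_s$ with $[V_1,V_i]=V_{i+1}$ for $1\le i\le s-1$ and $[V_1,V_s]=\{0\}$. Fix a basis $X_1,\dots,X_N$ of $\mathfrak g$ adapted to the stratification, let $d_j=i$ if $X_j\in V_i$ (so $d_1\le\dots\le d_N$), and identify $\mathbb G$ with $\mathbb R^N$ by the exponential coordinates $\exp(x_1X_1+\dots+x_NX_N)\leftrightarrow(x_1,\dots,x_N)$. Measure and measurability refer to the Lebesgue measure $\mathcal L^N$. Let $d(x,y)$ be the Carnot–Carathéodory distance, the infimum of the lengths $\int_0^1|u(t)|\,dt$ of absolutely continuous curves $\gamma\colon[0,1]\to\mathbb G$ from $x$ to $y$ with $\gamma'(t)=\sum_{d_j=1}u_j(t)X_j(\gamma(t))$ for almost every $t$, where $u_j\in L^1[0,1]$; let $B(x,r)$ be the corresponding balls. A measurable set $A$ has density one at $x$ (equivalently, $x$ is a density point of $A$) if $\mathcal L^N(B(x,r)\cap A)/\mathcal L^N(B(x,r))\to1$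 as $r\downarrow0$, and density zero at $x$ if $\mathbb G\setminus A$ has density one at $x$. For a measurable $g$ with domain $D$ (possibly undefined at $x$), $\operatorname{aplim}_{y\to x}g(y)=l$ means that $\{y\in D:|g(y)-l|\le\varepsilon\}$ has density one at $x$ for every $\varepsilon>0$, and $\operatorname{aplimsup}_{y\to x}g(y)$ is the infimum of all $\lambda\in\mathbb R$ such that $\{y\in D:g(y)>\lambda\}$ has density zero at $x$. For a multi-index $J=(j_1,\dots,j_N)$ of non-negative integers put $|J|_{\mathbb G}=\sum_i d_ij_i$, $J!=j_1!\cdots j_N!$ and $z^J=z_1^{j_1}\cdots z_N^{j_N}$. **Proposition (Uniqueness).** Let $D\subset\mathbb G$ be measurable, let $f\colon D\to\mathbb R$ be measurable, and let $x_0\in D$ be a density point of $D$. 1. Let $k\ge1$ be an integer. If both $p(x)=\sum_{|J|_{\mathbb G}\le k-1}\alpha_J\frac{(x_0^{-1}x)^J}{J!}$ and $q(x)=\sum_{|J|_{\mathbb G}\le k-1}\beta_J\frac{(x_0^{-1}x)^J}{J!}$ (with real coefficients) are approximate $(k-1)$-Taylor polynomials of $f$ at $x_0$, that is, $$\operatorname*{aplimsup}_{x\to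 x_0}\frac{|f(x)-p(x)|}{d(x,x_0)^k}<\infty\quad\text{and}\quad\operatorname*{aplimsup}_{x\to x_0}\frac{|f(x)-q(x)|}{d(x,x_0)^k}<\infty,$$ then $\alpha_J=\beta_J$ for all $J$ with $|J|_{\mathbb G}\le k-1$; hence $p=q$. 2. Let $k\ge0$ be an integer. If both $p(x)=\sum_{|J|_{\mathbb G}\le k}\alpha_J\frac{(x_0^{-1}x)^J}{J!}$ and $q(x)=\sum_{|J|_{\mathbb G}\le k}\beta_J\frac{(x_0^{-1}x)^J}{J!}$ (with real coefficients) are approximate derivatives of order $k$ of $f$ at $x_0$, that is, $$\operatorname*{aplim}_{x\to x_0}\frac{|f(x)-p(x)|}{d(x,x_0)^k}=0\quad\text{and}\quad\operatorname*{aplim}_{x\to x_0}\frac{|f(x)-q(x)|}{d(x,x_0)^k}=0,$$ then $\alpha_J=\beta_J$ for all $J$ with $|J|_{\mathbb G}\le k$; hence $p=q$. -/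

import Mathlib

open MeasureTheory Set Filter Topology
open scoped ContDiff

/-- The underlying space `ℝ^N` of a Carnot group in exponential coordinates. -/
abbrev RSpace (N : ℕ) : Type := EuclideanSpace ℝ (Fin N)

/-- A Lie group structure on the manifold `ℝ^N` with identity element `0`. -/
structure LieGroupLaw (N : ℕ) where
  mul : RSpace N → RSpace N → RSpace N
  inv : RSpace N → RSpace N
  mul_assoc : ∀ x y z, mul (mul x y) z = mul x (mul y z)
  zero_mul : ∀ x, mul 0 x = x
  mul_zero : ∀ x, mul x 0 = x
  inv_mul : ∀ x, mul (inv x) x = 0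
  contDiff_mul : ContDiff ℝ ∞ (fun p : RSpace N × RSpace N => mul p.1 p.2)
  contDiff_inv : ContDiff ℝ ∞ inv

namespace LieGroupLaw

variable {N : ℕ} (G : LieGroupLaw N)

/-- The left invariant vector field `X_j` whose value at the identity is the `j`-th coordinate
vector: `X_j(x)` is the image of that vector under the differential at `0` of left translation
by `x`. -/
noncomputable def X (j : Fin N) : RSpace N → RSpace N :=
  fun x => fderiv ℝ (fun y => G.mul x y) 0 (EuclideanSpace.single j 1)

/-- The span, in the Lie algebra of left invariant vector fields, of the `X_j` with
`deg j = i`. -/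
noncomputable def layer (deg : Fin N → ℕ) (i : ℕ) : Submodule ℝ (RSpace N → RSpace N) :=
  Submodule.span ℝ (G.X '' {j | deg j = i})

/-- The span of all brackets `[A, B]` with `A ∈ V` and `B ∈ W`. -/
noncomputable def bracketSpan {N : ℕ} (V W : Submodule ℝ (RSpace N → RSpace N)) :
    Submodule ℝ (RSpace N → RSpace N) :=
  Submodule.span ℝ {Z | ∃ A ∈ V, ∃ B ∈ W, Z = VectorField.lieBracket ℝ A B}

end LieGroupLaw

/-- A Carnot group of step `s` and dimension `N`, identified with `ℝ^N` by means of exponential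
coordinates with respect to a basis `X_1, …, X_N` of its Lie algebra adapted to the
stratification. The natural number `deg j` is the homogeneity of the `j`-th coordinate: the
`i`-th layer `V_i` of the stratification is spanned by the `X_j` with `deg j = i`. -/
structure CarnotGroup (N s : ℕ) extends LieGroupLaw N where
  deg : Fin N → ℕ
  one_le_deg : ∀ j, 1 ≤ deg j
  deg_le : ∀ j, deg j ≤ s
  deg_mono : Monotone deg
  /-- The coordinates are exponential: `t ↦ t x` is the integral curve through the identity of
  `x_1 X_1 + ⋯ + x_N X_N`, that is, `exp (x_1 X_1 + ⋯ + x_N X_N) = x`. -/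
  exp_coord : ∀ (x : RSpace N) (t : ℝ),
    HasDerivAt (fun τ : ℝ => τ • x) (∑ j, x j • toLieGroupLaw.X j (t • x)) t
  /-- `[V_1, V_i] = V_{i+1}` for `1 ≤ i ≤ s - 1`. -/
  bracket_layer : ∀ i, 1 ≤ i → i < s →
    LieGroupLaw.bracketSpan (toLieGroupLaw.layer deg 1) (toLieGroupLaw.layer deg i) =
      toLieGroupLaw.layer deg (i + 1)
  /-- `[V_1, V_s] = 0`. -/
  bracket_last :
    LieGroupLaw.bracketSpan (toLieGroupLaw.layer deg 1) (toLieGroupLaw.layer deg s) = ⊥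

/-- Absolutely continuous curves on `[a, b]`: differentiable almost everywhere with integrable
derivative, and equal to the integral of the derivative. -/
def IsACCurve {N : ℕ} (γ : ℝ → RSpace N) (a b : ℝ) : Prop :=
  (∀ᵐ t ∂(volume.restrict (Icc a b)), DifferentiableAt ℝ γ t) ∧
  IntervalIntegrable (deriv γ) volume a b ∧
  ∀ t₁ ∈ Icc a b, ∀ t₂ ∈ Icc a b, γ t₂ - γ t₁ = ∫ t in t₁..t₂, deriv γ t

namespace CarnotGroup

variable {N s : ℕ} (G : CarnotGroup N s)

/-- The indices of the horizontal vector fields (those in the first layer). -/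
abbrev HIndex : Type := {j : Fin N // G.deg j = 1}

/-- `γ` is a horizontal curve on `[a, b]` with controls `u_j ∈ L¹[a, b]`. -/
def IsHorizontal (γ : ℝ → RSpace N) (u : ℝ → EuclideanSpace ℝ G.HIndex) (a b : ℝ) : Prop :=
  IsACCurve γ a b ∧
  (∀ j, IntervalIntegrable (fun t => u t j) volume a b) ∧
  ∀ᵐ t ∂(volume.restrict (Icc a b)),
    deriv γ t = ∑ j : G.HIndex, u t j • G.X j (γ t)

/-- The Carnot–Carathéodory distance: the infimum of the lengths `∫ |u|` of horizontal curves
on `[0, 1]` that join `x` to `y`. -/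
noncomputable def ccDist (x y : RSpace N) : ℝ :=
  sInf {L : ℝ | ∃ (γ : ℝ → RSpace N) (u : ℝ → EuclideanSpace ℝ G.HIndex),
    G.IsHorizontal γ u 0 1 ∧ γ 0 = x ∧ γ 1 = y ∧ L = ∫ t in (0 : ℝ)..1, ‖u t‖}

/-- The open ball for the Carnot–Carathéodory distance. -/
def ccBall (x : RSpace N) (r : ℝ) : Set (RSpace N) := {y | G.ccDist x y < r}

/-- The set `A` has density one at `x` (with respect to Lebesgue measure and the balls of the
Carnot–Carathéodory distance). -/
def HasDensityOne (A : Set (RSpace N)) (x : RSpace N) : Prop :=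
  Tendsto (fun r : ℝ => volume (G.ccBall x r ∩ A) / volume (G.ccBall x r)) (𝓝[>] 0) (𝓝 1)

/-- The set `A` has density zero at `x`. -/
def HasDensityZero (A : Set (RSpace N)) (x : RSpace N) : Prop :=
  G.HasDensityOne Aᶜ x

/-- `aplim_{y → x} g(y) = l` for a function `g` with domain `D`; the values of `g` outside `D`
play no role. -/
def ApLim (D : Set (RSpace N)) (g : RSpace N → ℝ) (x : RSpace N) (l : ℝ) : Prop :=
  ∀ ε : ℝ, 0 < ε → G.HasDensityOne {y | y ∈ D ∧ |g y - l| ≤ ε} x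

/-- `aplimsup_{y → x} g(y)` for a function `g` with domain `D`, as an extended real number. -/
noncomputable def apLimsup (D : Set (RSpace N)) (g : RSpace N → ℝ) (x : RSpace N) : EReal :=
  sInf {c : EReal | ∃ l : ℝ, c = (l : EReal) ∧ G.HasDensityZero {y | y ∈ D ∧ l < g y} x}

/-- The homogeneous norm `|J| = ∑ deg j * J_j` of a multi-index. -/
def hnorm (J : Fin N → ℕ) : ℕ := ∑ j, G.deg j * J j

/-- The finite set of multi-indices of homogeneous norm at most `k`. -/
def multiIndices (k : ℕ) : Finset (Fin N → ℕ) :=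
  (Fintype.piFinset fun _ : Fin N => Finset.range (k + 1)).filter fun J => G.hnorm J ≤ k

theorem mem_multiIndices (k : ℕ) (J : Fin N → ℕ) :
    J ∈ G.multiIndices k ↔ G.hnorm J ≤ k := by
  simp only [multiIndices, Finset.mem_filter, Fintype.mem_piFinset, Finset.mem_range,
    and_iff_right_iff_imp]
  intro h j
  have h1 : G.deg j * J j ≤ G.hnorm J :=
    Finset.single_le_sum (f := fun j => G.deg j * J j) (fun _ _ => Nat.zero_le _)
      (Finset.mem_univ j)
  have h2 : J j ≤ G.deg j * J j := Nat.le_mul_of_pos_left _ (G.one_le_deg j)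
  omega

/-- The polynomial centred at `x₀`, of homogeneous degree at most `k`, with coefficients `α`:
`∑_{|J| ≤ k} α_J (x₀⁻¹ x)^J / J!`. -/
noncomputable def centredPoly (x₀ : RSpace N) (k : ℕ) (α : (Fin N → ℕ) → ℝ) (x : RSpace N) : ℝ :=
  ∑ J ∈ G.multiIndices k,
    α J * ((∏ j, (G.mul (G.inv x₀) x) j ^ J j) / ((∏ j, (J j).factorial : ℕ) : ℝ))

/-- The polynomial centred at `x₀` with coefficients `α_J`, `|J| ≤ k - 1`, is an approximate
`(k - 1)`-Taylor polynomial at `x₀` of the function `f` with domain `D` (for `k ≥ 1`). -/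
def IsApproxTaylor (D : Set (RSpace N)) (f : RSpace N → ℝ) (x₀ : RSpace N) (k : ℕ)
    (α : (Fin N → ℕ) → ℝ) : Prop :=
  G.apLimsup D (fun x => |f x - G.centredPoly x₀ (k - 1) α x| / G.ccDist x x₀ ^ k) x₀ < ⊤

/-- The polynomial centred at `x₀` with coefficients `α_J`, `|J| ≤ k`, is an approximate
derivative of order `k` at `x₀` of the function `f` with domain `D`. -/
def IsApproxDeriv (D : Set (RSpace N)) (f : RSpace N → ℝ) (x₀ : RSpace N) (k : ℕ)
    (α : (Fin N → ℕ) → ℝ) : Prop :=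
  G.ApLim D (fun x => |f x - G.centredPoly x₀ k α x| / G.ccDist x x₀ ^ k) x₀ 0

end CarnotGroup

/-!
The difference `P` of the two polynomials, written in the coordinates `z = x₀⁻¹ x`, is small
compared with `d(x, x₀) ^ m` on a set that fills `B(x₀, r)` asymptotically as `r ↓ 0`, where `m` is
`k - 1` or `k`. Blow up by `z ↦ x₀ · δ_r z`, with `δ_r` the anisotropic dilation: this map takes the
unit ball `S` at the origin to `B(x₀, r)` and multiplies Lebesgue measure by a constant. Hence
`r ^ (-m) P(δ_r z) → 0` in measure on `S`. If the parts of `P` of homogeneous degree below `h`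
vanish and `h ≤ m`, then `r ^ (-h) P(δ_r z)` converges pointwise to the part of degree `h`, which
thus vanishes almost everywhere on `S`; since `S` has positive measure and the zero set of a nonzero
polynomial is null, that part is zero (`CarnotGroup.coeff_eq_zero_of_tendsto`).

The blow-up needs the distance and the measure to be left invariant and homogeneous. Both follow
from the homogeneity `δ_r A(x) = A(δ_r x) δ_r` of the left invariant frame, where `A(x)` is the
differential at the identity of the left translation by `x` (`CarnotGroup.dil_dL`). In exponential
coordinates the Euler field is `∑ x_j X_j`, and bracketing it with the frame gives the equation
`DA(x)x = A(x) ad(x) + A(x) - A(x)²` along rays. As the Lie algebra is graded, by the Jacobi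
identity, the dilated frame solves the same equation, whose solution is unique
(`eq_of_radial_riccati`). Homogeneity makes `det A` constant along dilations, hence equal to `1`, so
left translations preserve volume (`CarnotGroup.measurePreserving_mul_left`).

Three facts about the distance are usually quoted from Chow's theorem: the measurability of the
balls, the positivity and finiteness of their measure, and `d(x, x₀) > 0` for almost every `x`. They
are obtained here by other means. Measurability is avoided by working with outer measure, splitting
the balls only by sets defined through `f` and the polynomials. The ratio in the definition of
density one can only tend to `1` if the balls have positive finite measure, so this is part of the
assumption on `D`. Finally, the points at distance zero from the origin form a dilation invariant
set of finite measure, which is therefore null.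
-/

/-! ### Zero sets of polynomials -/

/-- The zero set of a nonzero real polynomial is Lebesgue null: induction on the number of
variables with the Fubini theorem, with the first variable split off. -/
theorem MvPolynomial.volume_zeroSet_fin_eq_zero :
    ∀ (n : ℕ) (p : MvPolynomial (Fin n) ℝ), p ≠ 0 →
      volume {x : Fin n → ℝ | MvPolynomial.eval x p = 0} = 0 := by
  intro n
  induction n with
  | zero =>
    intro p hp
    have : {x : Fin 0 → ℝ | MvPolynomial.eval x p = 0} = ∅ := by
      rw [MvPolynomial.eq_C_of_isEmpty p] at hp ⊢
      ext x
      simpa using fun h => hp (by simp [h])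
    simp [this]
  | succ n ih =>
    intro p hp
    set q := MvPolynomial.finSuccEquiv ℝ n p with hq
    have hq0 : q ≠ 0 := by simpa [hq] using hp
    have hlead := ih q.leadingCoeff (by simpa using hq0)
    let e := MeasurableEquiv.piFinSuccAbove (fun _ : Fin (n + 1) => ℝ) 0
    have hmp : MeasurePreserving e := volume_preserving_piFinSuccAbove (fun _ => ℝ) 0
    have hmeas : MeasurableSet {x : Fin (n + 1) → ℝ | MvPolynomial.eval x p = 0} :=
      (isClosed_eq (MvPolynomial.continuous_eval p) continuous_const).measurableSet
    rw [← hmp.symm.measure_preimage hmeas.nullMeasurableSet, Measure.volume_eq_prod,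
      Measure.prod_apply_symm (e.symm.measurable hmeas)]
    have hae : ∀ᵐ y : Fin n → ℝ, MvPolynomial.eval y q.leadingCoeff ≠ 0 := by
      rw [ae_iff]
      simpa using hlead
    rw [lintegral_congr_ae (g := fun _ => 0) ?_, lintegral_zero]
    filter_upwards [hae] with y hy
    -- outside the zero set of the leading coefficient each slice is the finite root set of a
    -- nonzero polynomial in one variable
    have hr : q.map (MvPolynomial.eval y) ≠ 0 := fun h => hy (by
      simpa [Polynomial.coeff_map] using congrArg (fun r => r.coeff q.natDegree) h)
    refine measure_mono_null (fun t ht => ?_)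
      ((Polynomial.finite_setOfPred_isRoot hr).measure_zero volume)
    have ht' : MvPolynomial.eval (Fin.cons t y : Fin (n + 1) → ℝ) p = 0 := by
      simpa [e, MeasurableEquiv.piFinSuccAbove, Fin.insertNthEquiv] using ht
    rw [MvPolynomial.eval_eq_eval_mv_eval'] at ht'
    exact ht'

theorem MvPolynomial.volume_zeroSet_eq_zero {n : ℕ} {p : MvPolynomial (Fin n) ℝ} (hp : p ≠ 0) :
    volume {x : EuclideanSpace ℝ (Fin n) | MvPolynomial.eval (fun i => x i) p = 0} = 0 := by
  have hc : IsClosed {x : Fin n → ℝ | MvPolynomial.eval x p = 0} :=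
    isClosed_eq (MvPolynomial.continuous_eval p) continuous_const
  have := (PiLp.volume_preserving_ofLp (Fin n)).measure_preimage
    hc.measurableSet.nullMeasurableSet
  rw [MvPolynomial.volume_zeroSet_fin_eq_zero n p hp] at this
  exact this

/-! ### Absolutely continuous curves -/

/-- An absolutely continuous curve on `[a, b]` stays absolutely continuous in the sense of
`AbsolutelyContinuousOnInterval` after composition with a `C^1` map. -/
theorem IsACCurve.absolutelyContinuousOnInterval_comp {N : ℕ} {F : Type*} [NormedAddCommGroup F]
    [NormedSpace ℝ F] {γ : ℝ → RSpace N} {a b : ℝ} (hab : a ≤ b) (hγ : IsACCurve γ a b)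
    {φ : RSpace N → F} (hφ : ContDiff ℝ 1 φ) :
    AbsolutelyContinuousOnInterval (fun t => φ (γ t)) a b := by
  obtain ⟨-, hint, hftc⟩ := hγ
  have hG := hint.norm.absolutelyContinuousOnInterval_intervalIntegral (c := a) left_mem_uIcc
  have hint' : ∀ t₁ ∈ Icc a b, ∀ t₂ ∈ Icc a b, IntervalIntegrable (deriv γ) volume t₁ t₂ :=
    fun t₁ h₁ t₂ h₂ => hint.mono_set (by
      rw [uIcc_of_le hab]; exact uIcc_subset_Icc h₁ h₂)
  have hdist : ∀ t₁ ∈ Icc a b, ∀ t₂ ∈ Icc a b,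
      dist (γ t₁) (γ t₂) ≤ dist (∫ v in a..t₁, ‖deriv γ v‖) (∫ v in a..t₂, ‖deriv γ v‖) := by
    intro t₁ h₁ t₂ h₂
    have ha : a ∈ Icc a b := left_mem_Icc.2 hab
    rw [dist_eq_norm, hftc t₂ h₂ t₁ h₁, Real.dist_eq,
      intervalIntegral.integral_interval_sub_left (hint' a ha t₁ h₁).norm (hint' a ha t₂ h₂).norm]
    exact intervalIntegral.norm_integral_le_abs_integral_norm
  have hcont : ContinuousOn γ (Icc a b) := by
    have hc := hG.continuousOn
    rw [uIcc_of_le hab] at hc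
    intro t ht
    have h0 := tendsto_iff_dist_tendsto_zero.1 (hc t ht)
    refine tendsto_iff_dist_tendsto_zero.2 (squeeze_zero'
      (Eventually.of_forall fun _ => dist_nonneg) ?_ h0)
    filter_upwards [self_mem_nhdsWithin] with u hu using hdist u hu t ht
  obtain ⟨R, hR⟩ := (isCompact_Icc.image_of_continuousOn hcont).isBounded.subset_closedBall 0
  obtain ⟨K, hK⟩ := hφ.contDiffOn.exists_lipschitzOnWith one_ne_zero
    (convex_closedBall (0 : RSpace N) R) (isCompact_closedBall 0 R)
  have hle : ∀ t₁ ∈ Icc a b, ∀ t₂ ∈ Icc a b, dist (φ (γ t₁)) (φ (γ t₂)) ≤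
      K * dist (∫ v in a..t₁, ‖deriv γ v‖) (∫ v in a..t₂, ‖deriv γ v‖) := fun t₁ h₁ t₂ h₂ =>
    (hK.dist_le_mul _ (hR (mem_image_of_mem γ h₁)) _ (hR (mem_image_of_mem γ h₂))).trans
      (by gcongr; exact hdist t₁ h₁ t₂ h₂)
  unfold AbsolutelyContinuousOnInterval at hG ⊢
  have hG' := hG.const_mul (K : ℝ)
  rw [mul_zero] at hG'
  refine squeeze_zero' (Eventually.of_forall fun E => Finset.sum_nonneg fun _ _ => dist_nonneg)
    ?_ hG'
  filter_upwards [mem_inf_of_right (mem_principal_self _)] with E hE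
  rw [Finset.mul_sum]
  refine Finset.sum_le_sum fun i hi => ?_
  have h := hE.1 i hi
  rw [uIcc_of_le hab] at h
  exact hle _ h.1 _ h.2

/-- Smooth maps send absolutely continuous curves to absolutely continuous curves. -/
theorem IsACCurve.comp_contDiff {N : ℕ} {γ : ℝ → RSpace N} {a b : ℝ} (hab : a ≤ b)
    (hγ : IsACCurve γ a b) {φ : RSpace N → RSpace N} (hφ : ContDiff ℝ 1 φ) :
    IsACCurve (fun t => φ (γ t)) a b := by
  have hdiff : ∀ᵐ t ∂(volume.restrict (Icc a b)), DifferentiableAt ℝ (fun t => φ (γ t)) t := by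
    filter_upwards [hγ.1] with t ht
    exact DifferentiableAt.comp t (hφ.differentiable one_ne_zero (γ t)) ht
  have hac : ∀ i, AbsolutelyContinuousOnInterval (fun t => φ (γ t) i) a b := fun i =>
    hγ.absolutelyContinuousOnInterval_comp (φ := fun x => φ x i) hab (by fun_prop)
  clear hγ hφ
  have hcoord : ∀ᵐ t ∂(volume.restrict (Icc a b)), ∀ i,
      deriv (fun t => φ (γ t) i) t = deriv (fun t => φ (γ t)) t i := by
    filter_upwards [hdiff] with t ht i
    have h : HasDerivAt (fun t => φ (γ t) i) (deriv (fun t => φ (γ t)) t i) t :=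
      (EuclideanSpace.proj (𝕜 := ℝ) i).hasFDerivAt.comp_hasDerivAt t ht.hasDerivAt
    exact h.deriv
  have hint : IntervalIntegrable (deriv fun t => φ (γ t)) volume a b := by
    rw [intervalIntegrable_iff_integrableOn_Icc_of_le hab]
    refine Integrable.of_eval_piLp fun i => ?_
    have := (intervalIntegrable_iff_integrableOn_Icc_of_le hab).1 (hac i).intervalIntegrable_deriv
    refine Integrable.congr this ?_
    filter_upwards [hcoord] with t ht using ht i
  refine ⟨hdiff, hint, fun t₁ h₁ t₂ h₂ => ?_⟩
  have hsub : uIcc t₁ t₂ ⊆ uIcc a b := by rw [uIcc_of_le hab]; exact uIcc_subset_Icc h₁ h₂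
  ext i
  have h1 := (EuclideanSpace.proj (𝕜 := ℝ) i).intervalIntegral_comp_comm (hint.mono_set hsub)
  have h2 := ((hac i).mono hsub).integral_deriv_eq_sub
  rw [PiLp.sub_apply, ← h2]
  refine Eq.trans ?_ h1
  refine intervalIntegral.integral_congr_ae ?_
  rw [ae_restrict_iff' measurableSet_Icc] at hcoord
  filter_upwards [hcoord] with t ht htm
  exact ht (uIcc_subset_Icc h₁ h₂ (uIoc_subset_uIcc htm)) i

/-! ### Left invariant vector fields -/

theorem EuclideanSpace.eq_sum_smul_single {N : ℕ} (v : EuclideanSpace ℝ (Fin N)) :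
    v = ∑ j, v j • EuclideanSpace.single j (1 : ℝ) := by
  ext k; simp [Finset.sum_apply, Pi.single_apply]

namespace LieGroupLaw

variable {N : ℕ} (G : LieGroupLaw N)

/-- The differential at the identity of the left translation by `x`. For a vector `v`, the field
`x ↦ G.dL x v` is the left invariant vector field whose value at the identity is `v`. -/
noncomputable def dL (x : RSpace N) : RSpace N →L[ℝ] RSpace N :=
  fderiv ℝ (fun y => G.mul x y) 0

theorem X_eq_dL (j : Fin N) : G.X j = fun x => G.dL x (EuclideanSpace.single j 1) := rfl

theorem contDiff_dL : ContDiff ℝ ∞ G.dL :=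
  ContDiff.fderiv (f := G.mul) G.contDiff_mul contDiff_const (by simp)

theorem contDiff_dL_apply (v : RSpace N) : ContDiff ℝ ∞ fun x => G.dL x v :=
  G.contDiff_dL.clm_apply contDiff_const

theorem contDiff_mul_left (a : RSpace N) : ContDiff ℝ ∞ (G.mul a) :=
  G.contDiff_mul.comp (contDiff_const.prodMk contDiff_id)

theorem dL_zero : G.dL 0 = ContinuousLinearMap.id ℝ _ := by
  have : (fun y => G.mul 0 y) = id := funext G.zero_mul
  rw [dL, this, fderiv_id]

theorem mul_inv (x : RSpace N) : G.mul x (G.inv x) = 0 := by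
  have h : G.mul (G.inv (G.inv x)) (G.mul (G.inv x) (G.mul x (G.inv x))) = 0 := by
    rw [← G.mul_assoc (G.inv x), G.inv_mul, G.zero_mul, G.inv_mul]
  rwa [← G.mul_assoc, G.inv_mul, G.zero_mul] at h

theorem inv_mul_cancel_left (a x : RSpace N) : G.mul (G.inv a) (G.mul a x) = x := by
  rw [← G.mul_assoc, G.inv_mul, G.zero_mul]

theorem mul_inv_cancel_left (a x : RSpace N) : G.mul a (G.mul (G.inv a) x) = x := by
  rw [← G.mul_assoc, G.mul_inv, G.zero_mul]

/-- Left invariance of the fields `x ↦ G.dL x v`. -/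
theorem fderiv_mul_left_comp_dL (a x : RSpace N) :
    (fderiv ℝ (G.mul a) x).comp (G.dL x) = G.dL (G.mul a x) := by
  have h : (fun y => G.mul (G.mul a x) y) = G.mul a ∘ fun y => G.mul x y :=
    funext fun y => G.mul_assoc a x y
  rw [dL, dL, h, fderiv_comp, G.mul_zero]
  · exact (G.contDiff_mul_left a).differentiable (by simp) _
  · exact (G.contDiff_mul_left x).differentiable (by simp) _

/-- The linear isomorphism of `ℝ^N` with the left invariant vector fields. -/
noncomputable def leftInvField : RSpace N →ₗ[ℝ] (RSpace N → RSpace N) where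
  toFun v := fun x => G.dL x v
  map_add' v w := by ext1 x; simp
  map_smul' c v := by ext1 x; simp

/-- The vectors all of whose coordinates with degree other than `i` vanish. -/
def degSubspace (deg : Fin N → ℕ) (i : ℕ) : Submodule ℝ (RSpace N) where
  carrier := {v | ∀ j, deg j ≠ i → v j = 0}
  add_mem' hv hw j hj := by simp [hv j hj, hw j hj]
  zero_mem' j _ := by simp
  smul_mem' c v hv j hj := by simp [hv j hj]

theorem single_mem_degSubspace (deg : Fin N → ℕ) (j : Fin N) (c : ℝ) :
    EuclideanSpace.single j c ∈ degSubspace deg (deg j) := by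
  intro k hk
  have : k ≠ j := fun h => hk (h ▸ rfl)
  simp [this]

theorem layer_eq_map (deg : Fin N → ℕ) (i : ℕ) :
    G.layer deg i = (degSubspace deg i).map G.leftInvField := by
  apply le_antisymm
  · refine Submodule.span_le.2 ?_
    rintro _ ⟨j, rfl, rfl⟩
    exact ⟨_, single_mem_degSubspace deg j 1, rfl⟩
  · rintro _ ⟨v, hv, rfl⟩
    rw [EuclideanSpace.eq_sum_smul_single v, map_sum]
    refine Submodule.sum_mem _ fun j _ => ?_
    rw [map_smul]
    by_cases hj : deg j = i
    · exact Submodule.smul_mem _ _ (Submodule.subset_span ⟨j, hj, rfl⟩)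
    · rw [hv j hj, zero_smul]; exact zero_mem _

theorem contDiff_of_mem_layer {deg : Fin N → ℕ} {i : ℕ} {A : RSpace N → RSpace N}
    (hA : A ∈ G.layer deg i) : ContDiff ℝ ∞ A := by
  rw [layer_eq_map] at hA
  obtain ⟨v, -, rfl⟩ := hA
  exact G.contDiff_dL_apply v

/-- The Lie bracket of the Lie algebra, transported to the tangent space `ℝ^N` at the identity. -/
noncomputable def bracket : RSpace N →L[ℝ] RSpace N →L[ℝ] RSpace N :=
  fderiv ℝ G.dL 0 - (fderiv ℝ G.dL 0).flip

theorem lieBracket_leftInvField (v w x : RSpace N) :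
    VectorField.lieBracket ℝ (G.leftInvField v) (G.leftInvField w) x =
      fderiv ℝ G.dL x (G.dL x v) w - fderiv ℝ G.dL x (G.dL x w) v := by
  have h : ∀ v y, fderiv ℝ (G.leftInvField v) x y = fderiv ℝ G.dL x y v := by
    intro v y
    have h1 := ((G.contDiff_dL.differentiable (by simp)) x).hasFDerivAt.clm_apply
      (hasFDerivAt_const v x)
    have h2 : fderiv ℝ (G.leftInvField v) x = _ := h1.fderiv
    rw [h2]
    simp
  simp only [VectorField.lieBracket, h]
  rfl

theorem bracket_apply (v w : RSpace N) :
    G.bracket v w = VectorField.lieBracket ℝ (G.leftInvField v) (G.leftInvField w) 0 := by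
  rw [lieBracket_leftInvField, dL_zero]
  rfl

end LieGroupLaw

/-! ### A singular equation along rays -/

/-- The equation `DA(x)x = A(x) b(x) + A(x) - A(x)²`, singular at the origin, has at most one `C¹`
solution with `A(0) = 1`: if `A` and `B` are two of them, then `t (A(tx) - B(tx))` solves a linear
equation with bounded coefficients and vanishes at `t = 0`. -/
theorem eq_of_radial_riccati {E : Type*} [NormedAddCommGroup E] [NormedSpace ℝ E]
    {A B : E → E →L[ℝ] E} (b : E →L[ℝ] E →L[ℝ] E) (hA : ContDiff ℝ 1 A) (hB : ContDiff ℝ 1 B)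
    (hA0 : A 0 = 1) (hB0 : B 0 = 1)
    (hAeq : ∀ x, fderiv ℝ A x x = A x * b x + A x - A x * A x)
    (hBeq : ∀ x, fderiv ℝ B x x = B x * b x + B x - B x * B x) : A = B := by
  ext1 x
  have hline : ContDiff ℝ 1 fun t : ℝ => t • x := contDiff_id.smul contDiff_const
  have hderiv : ∀ {C : E → E →L[ℝ] E}, ContDiff ℝ 1 C → ∀ t : ℝ,
      HasDerivAt (fun t : ℝ => C (t • x)) (fderiv ℝ C (t • x) x) t := by
    intro C hC t
    have h1 : HasDerivAt (fun t : ℝ => t • x) x t := by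
      simpa using (hasDerivAt_id t).smul_const x
    exact ((hC.differentiable one_ne_zero (t • x)).hasFDerivAt).comp_hasDerivAt t h1
  have hbound : ∀ {C : E → E →L[ℝ] E}, ContDiff ℝ 1 C → C 0 = 1 →
      ∃ K : ℝ, ∀ t ∈ Icc (0 : ℝ) 1, ‖1 - C (t • x)‖ ≤ K * t := by
    intro C hC hC0
    obtain ⟨K, hK⟩ := ((hC.comp hline).contDiffOn (s := Icc (0 : ℝ) 1)).exists_lipschitzOnWith
      one_ne_zero (convex_Icc _ _) isCompact_Icc
    refine ⟨K, fun t ht => ?_⟩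
    have := hK.dist_le_mul 0 (by simp) t ht
    simpa [dist_eq_norm, hC0, abs_of_nonneg ht.1] using this
  obtain ⟨K, hK⟩ := hbound hA hA0
  obtain ⟨L, hL⟩ := hbound hB hB0
  set Y : ℝ → E →L[ℝ] E := fun t => t • (A (t • x) - B (t • x)) with hY
  have hYd : ∀ t, HasDerivAt Y (t • (fderiv ℝ A (t • x) x - fderiv ℝ B (t • x) x) +
      (1 : ℝ) • (A (t • x) - B (t • x))) t := fun t =>
    (hasDerivAt_id t).smul ((hderiv hA t).sub (hderiv hB t))
  have hzero := eq_zero_of_abs_deriv_le_mul_abs_self_of_eq_zero_right (f := Y) (a := 0) (b := 1)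
    (K := K + L + ‖b x‖)
    (fun t _ => (hYd t).continuousAt.continuousWithinAt)
    (fun t _ => (hYd t).hasDerivWithinAt) (by simp [hY]) ?_ 1 (by simp)
  · simpa [hY, sub_eq_zero] using hzero
  · intro t ht
    have ht' : t ∈ Icc (0 : ℝ) 1 := ⟨ht.1, ht.2.le⟩
    -- with `d = A - B` one has `A² - B² = A d + d B`, and
    -- `2 d - A d - d B = (1 - A) d + d (1 - B)`, where `1 - A` and `1 - B` are `O(t)`
    have hid : t • (fderiv ℝ A (t • x) x - fderiv ℝ B (t • x) x) +
        (1 : ℝ) • (A (t • x) - B (t • x)) =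
        (1 - A (t • x)) * (A (t • x) - B (t • x)) + (A (t • x) - B (t • x)) * (1 - B (t • x)) +
          t • ((A (t • x) - B (t • x)) * b x) := by
      have h1 := hAeq (t • x)
      have h2 := hBeq (t • x)
      rw [map_smul, map_smul, mul_smul_comm] at h1 h2
      rw [smul_sub, h1, h2, one_smul, sub_mul (A (t • x)) (B (t • x)) (b x), smul_sub]
      noncomm_ring
    rw [hid, hY, norm_smul, Real.norm_of_nonneg ht.1]
    set d := A (t • x) - B (t • x)
    calc _ ≤ ‖1 - A (t • x)‖ * ‖d‖ + ‖d‖ * ‖1 - B (t • x)‖ + t * (‖d‖ * ‖b x‖) := by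
          refine (norm_add₃_le).trans ?_
          rw [norm_smul, Real.norm_of_nonneg ht.1]
          gcongr
          exacts [norm_mul_le _ _, norm_mul_le _ _, ht.1, norm_mul_le _ _]
      _ ≤ (K * t) * ‖d‖ + ‖d‖ * (L * t) + t * (‖d‖ * ‖b x‖) := by
          gcongr
          exacts [hK t ht', hL t ht']
      _ = (K + L + ‖b x‖) * (t * ‖d‖) := by ring

/-! ### The grading of the Lie algebra -/

namespace CarnotGroup

variable {N s : ℕ} (G : CarnotGroup N s)

open VectorField LieGroupLaw

theorem lieBracket_mem_layer_of_one {i : ℕ} (hi : 1 ≤ i) {A B : RSpace N → RSpace N}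
    (hA : A ∈ G.layer G.deg 1) (hB : B ∈ G.layer G.deg i) :
    lieBracket ℝ A B ∈ G.layer G.deg (i + 1) := by
  have hmem : lieBracket ℝ A B ∈ bracketSpan (G.layer G.deg 1) (G.layer G.deg i) :=
    Submodule.subset_span ⟨A, hA, B, hB, rfl⟩
  rcases lt_trichotomy i s with h | rfl | h
  · rwa [G.bracket_layer i hi h] at hmem
  · rw [G.bracket_last] at hmem
    rw [(Submodule.mem_bot ℝ).1 hmem]
    exact zero_mem _
  · have h0 : G.layer G.deg i = ⊥ := by
      have : {j | G.deg j = i} = ∅ := by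
        ext j; simpa using ((G.deg_le j).trans_lt h).ne
      rw [layer, this]; simp
    rw [h0, Submodule.mem_bot] at hB
    rw [hB, lieBracket_zero_right]
    exact zero_mem _

/-- The stratification is a grading, `[V_i, V_j] ⊆ V_{i+j}`; by induction on `i`, from
`V_{i+1} = [V_1, V_i]` and the Jacobi identity. -/
theorem lieBracket_mem_layer {i : ℕ} (hi : 1 ≤ i) : ∀ {j : ℕ}, 1 ≤ j →
    ∀ {A B : RSpace N → RSpace N}, A ∈ G.layer G.deg i → B ∈ G.layer G.deg j →
      lieBracket ℝ A B ∈ G.layer G.deg (i + j) := by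
  induction i, hi using Nat.le_induction with
  | base =>
    intro j hj A B hA hB
    rw [add_comm]
    exact G.lieBracket_mem_layer_of_one hj hA hB
  | succ i hi ih =>
    intro j hj A B hA hB
    -- for `i ≥ s` the layer `V_{i+1}` vanishes, no coordinate having a degree beyond `s`
    rcases lt_or_ge i s with his | his
    · have hBs := G.contDiff_of_mem_layer hB
      rw [← G.bracket_layer i hi his] at hA
      have hle : bracketSpan (G.layer G.deg 1) (G.layer G.deg i) ≤ G.layer G.deg (i + 1) :=
        (G.bracket_layer i hi his).le
      refine (Submodule.span_induction (p := fun A _ => ContDiff ℝ ∞ A ∧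
        lieBracket ℝ A B ∈ G.layer G.deg (i + 1 + j)) ?_ ?_ ?_ ?_ hA).2
      · rintro _ ⟨a, ha, b, hb, rfl⟩
        have has := G.contDiff_of_mem_layer ha
        have hbs := G.contDiff_of_mem_layer hb
        refine ⟨has.lieBracket_vectorField hbs (by simp), ?_⟩
        have hJ : lieBracket ℝ (lieBracket ℝ a b) B =
            lieBracket ℝ a (lieBracket ℝ b B) - lieBracket ℝ b (lieBracket ℝ a B) := by
          ext1 x
          have hn : minSmoothness ℝ 2 ≤ (∞ : ℕ∞ω) := by
            simp [minSmoothness_of_isRCLikeNormedField]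
            exact WithTop.coe_le_coe.2 le_top
          rw [Pi.sub_apply, leibniz_identity_lieBracket hn has.contDiffAt hbs.contDiffAt
            hBs.contDiffAt, add_sub_cancel_right]
        rw [hJ]
        refine Submodule.sub_mem _ ?_ ?_
        · have := G.lieBracket_mem_layer_of_one (by omega) ha (ih hj hb hB)
          rwa [show i + 1 + j = i + j + 1 by ring]
        · have := ih (by omega) hb (G.lieBracket_mem_layer_of_one hj ha hB)
          rwa [show i + 1 + j = i + (j + 1) by ring]
      · exact ⟨contDiff_const, by rw [lieBracket_zero_left]; exact zero_mem _⟩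
      · rintro A A' - - ⟨hA, hA1⟩ ⟨hA', hA1'⟩
        refine ⟨hA.add hA', ?_⟩
        have : lieBracket ℝ (A + A') B = lieBracket ℝ A B + lieBracket ℝ A' B := by
          ext1 x
          exact lieBracket_add_left (hA.differentiable (by simp) x)
            (hA'.differentiable (by simp) x)
        rw [this]
        exact add_mem hA1 hA1'
      · rintro c A - ⟨hA, hA1⟩
        refine ⟨contDiff_const.smul hA, ?_⟩
        have : lieBracket ℝ (c • A) B = c • lieBracket ℝ A B := by
          ext1 x
          exact lieBracket_const_smul_left (hA.differentiable (by simp) x)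
        rw [this]
        exact Submodule.smul_mem _ _ hA1
    · have h0 : G.layer G.deg (i + 1) = ⊥ := by
        have : {j | G.deg j = i + 1} = ∅ := by
          ext j; simpa using ((G.deg_le j).trans_lt (Nat.lt_succ_of_le his)).ne
        rw [layer, this]; simp
      rw [h0, Submodule.mem_bot] at hA
      rw [hA, lieBracket_zero_left]
      exact zero_mem _

/-! ### The left invariant frame in exponential coordinates -/

/-- The bracket of two fields of the frame is again a left invariant field, of the degree
prescribed by the grading. -/
theorem exists_lieBracket_single (i j : Fin N) : ∃ u ∈ degSubspace G.deg (G.deg i + G.deg j),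
    ∀ x, lieBracket ℝ (G.leftInvField (EuclideanSpace.single i 1))
      (G.leftInvField (EuclideanSpace.single j 1)) x = G.dL x u := by
  have hmem : ∀ k, G.leftInvField (EuclideanSpace.single k 1) ∈ G.layer G.deg (G.deg k) :=
    fun k => Submodule.subset_span ⟨k, rfl, rfl⟩
  have h := G.lieBracket_mem_layer (G.one_le_deg i) (G.one_le_deg j) (hmem i) (hmem j)
  rw [layer_eq_map] at h
  obtain ⟨u, hu, hux⟩ := h
  exact ⟨u, hu, fun x => congrFun hux.symm x⟩

theorem bracket_single_mem (i j : Fin N) :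
    G.bracket (EuclideanSpace.single i 1) (EuclideanSpace.single j 1) ∈
      degSubspace G.deg (G.deg i + G.deg j) := by
  obtain ⟨u, hu, hux⟩ := G.exists_lieBracket_single i j
  rw [bracket_apply, hux, dL_zero]
  exact hu

/-- The bracket of left invariant fields is left invariant. -/
theorem lieBracket_leftInvField_eq (v w x : RSpace N) :
    lieBracket ℝ (G.leftInvField v) (G.leftInvField w) x = G.dL x (G.bracket v w) := by
  have hbasis : ∀ i j, fderiv ℝ G.dL x (G.dL x (EuclideanSpace.single i 1))
      (EuclideanSpace.single j 1) - fderiv ℝ G.dL x (G.dL x (EuclideanSpace.single j 1))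
      (EuclideanSpace.single i 1) =
      G.dL x (G.bracket (EuclideanSpace.single i 1) (EuclideanSpace.single j 1)) := by
    intro i j
    obtain ⟨u, hu, hux⟩ := G.exists_lieBracket_single i j
    rw [bracket_apply, ← lieBracket_leftInvField, hux, hux, dL_zero]
    rfl
  let L := (fderiv ℝ G.dL x).comp (G.dL x)
  let F : RSpace N →L[ℝ] RSpace N →L[ℝ] RSpace N :=
    L - L.flip - (ContinuousLinearMap.compL ℝ _ _ _ (G.dL x)).comp G.bracket
  have hF : ∀ v w, F v w = fderiv ℝ G.dL x (G.dL x v) w - fderiv ℝ G.dL x (G.dL x w) v -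
    G.dL x (G.bracket v w) := fun v w => rfl
  have hF0 : F v w = 0 := by
    rw [EuclideanSpace.eq_sum_smul_single v, EuclideanSpace.eq_sum_smul_single w]
    simp only [map_sum, map_smul, _root_.sum_apply, _root_.smul_apply,
      hF, hbasis, sub_self, smul_zero, Finset.sum_const_zero]
  rw [hF, sub_eq_zero] at hF0
  rw [lieBracket_leftInvField, hF0]

/-- In exponential coordinates `x_1 X_1 + ⋯ + x_N X_N` is the Euler field. -/
theorem dL_apply_self (x : RSpace N) : G.dL x x = x := by
  have h1 := (G.exp_coord x 1).unique (by simpa using (hasDerivAt_id (1 : ℝ)).smul_const x)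
  rw [one_smul] at h1
  conv_lhs => rw [EuclideanSpace.eq_sum_smul_single x, map_sum]
  conv_rhs => rw [← h1]
  refine Finset.sum_congr rfl fun j _ => ?_
  rw [map_smul, ← EuclideanSpace.eq_sum_smul_single x]
  rfl

/-- The equation along rays satisfied by the left invariant frame in exponential coordinates,
obtained by bracketing the frame with the Euler field. -/
theorem fderiv_dL_apply_self (x : RSpace N) :
    fderiv ℝ G.dL x x = G.dL x * G.bracket x + G.dL x - G.dL x * G.dL x := by
  ext1 v
  have h1 := G.lieBracket_leftInvField_eq x v x
  rw [lieBracket_leftInvField, dL_apply_self] at h1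
  -- differentiate `A(y) y = y`
  have h2 : ∀ h, fderiv ℝ G.dL x h x = h - G.dL x h := by
    intro h
    have hd := ((G.contDiff_dL.differentiable (by simp)) x).hasFDerivAt.clm_apply (hasFDerivAt_id x)
    have he : (fun y => G.dL y (id y)) = id := funext G.dL_apply_self
    rw [he] at hd
    have := congrArg (fun T => T h) (hd.unique (hasFDerivAt_id x))
    simp at this
    exact eq_sub_of_add_eq' this
  rw [h2, sub_eq_iff_eq_add] at h1
  rw [h1]
  simp
  abel

/-! ### Dilations -/

/-- The anisotropic dilation `(δ_r x)_j = r ^ d_j x_j`. -/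
noncomputable def dil (r : ℝ) : RSpace N →L[ℝ] RSpace N :=
  LinearMap.toContinuousLinearMap
    { toFun := fun x => WithLp.toLp 2 fun j => r ^ G.deg j * x j
      map_add' := fun x y => by ext j; simp [mul_add]
      map_smul' := fun c x => by ext j; simp; ring }

@[simp]
theorem dil_apply (r : ℝ) (x : RSpace N) (j : Fin N) : G.dil r x j = r ^ G.deg j * x j := rfl

theorem dil_dil (r t : ℝ) (x : RSpace N) : G.dil r (G.dil t x) = G.dil (r * t) x := by
  ext j; simp [mul_pow]; ring

theorem dil_one (x : RSpace N) : G.dil 1 x = x := by ext j; simp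

theorem dil_dil_inv {r : ℝ} (hr : r ≠ 0) (x : RSpace N) : G.dil r (G.dil r⁻¹ x) = x := by
  rw [dil_dil, mul_inv_cancel₀ hr, dil_one]

theorem dil_inv_dil {r : ℝ} (hr : r ≠ 0) (x : RSpace N) : G.dil r⁻¹ (G.dil r x) = x := by
  rw [dil_dil, inv_mul_cancel₀ hr, dil_one]

theorem dil_of_mem_degSubspace (r : ℝ) {i : ℕ} {v : RSpace N} (hv : v ∈ degSubspace G.deg i) :
    G.dil r v = r ^ i • v := by
  ext j
  by_cases hj : G.deg j = i
  · simp [hj]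
  · simp [hv j hj]

/-- Dilations are automorphisms of the Lie algebra. -/
theorem dil_bracket (r : ℝ) (v w : RSpace N) :
    G.dil r (G.bracket v w) = G.bracket (G.dil r v) (G.dil r w) := by
  have hs : ∀ i, G.dil r (EuclideanSpace.single i 1) = r ^ G.deg i • EuclideanSpace.single i 1 :=
    fun i => G.dil_of_mem_degSubspace r (single_mem_degSubspace G.deg i 1)
  rw [EuclideanSpace.eq_sum_smul_single v, EuclideanSpace.eq_sum_smul_single w]
  simp only [map_sum, map_smul, _root_.sum_apply, _root_.smul_apply, hs,
    G.dil_of_mem_degSubspace r (G.bracket_single_mem _ _), pow_add]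
  refine Finset.sum_congr rfl fun i _ => ?_
  simp only [Finset.smul_sum, smul_smul]
  refine Finset.sum_congr rfl fun j _ => ?_
  congr 1
  ring

/-- Homogeneity of the left invariant frame: the dilated frame solves the same radial equation. -/
theorem dil_dL (r : ℝ) (hr : r ≠ 0) (x v : RSpace N) :
    G.dil r (G.dL x v) = G.dL (G.dil r x) (G.dil r v) := by
  let B : RSpace N → RSpace N →L[ℝ] RSpace N :=
    fun x => G.dil r * G.dL (G.dil r⁻¹ x) * G.dil r⁻¹
  have hinv : G.dil r * G.dil r⁻¹ = 1 := by ext1 x; exact G.dil_dil_inv hr x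
  have hinv' : G.dil r⁻¹ * G.dil r = 1 := by ext1 x; exact G.dil_inv_dil hr x
  have hA : ContDiff ℝ 1 G.dL := G.contDiff_dL.of_le (by simp)
  have hAd : ContDiff ℝ 1 fun x => G.dL (G.dil r⁻¹ x) := hA.comp (G.dil r⁻¹).contDiff
  have hB : ContDiff ℝ 1 B := (contDiff_const.mul hAd).mul contDiff_const
  have hBeq : ∀ x, fderiv ℝ B x x = B x * G.bracket x + B x - B x * B x := by
    intro x
    have h1 : HasFDerivAt (fun x => G.dL (G.dil r⁻¹ x)) _ x :=
      ((hA.differentiable one_ne_zero) (G.dil r⁻¹ x)).hasFDerivAt.comp x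
        (G.dil r⁻¹).hasFDerivAt
    have h2 := ((h1.const_mul (G.dil r)).mul_const' (G.dil r⁻¹)).fderiv
    have h3 : fderiv ℝ B x x = G.dil r * fderiv ℝ G.dL (G.dil r⁻¹ x) (G.dil r⁻¹ x) *
        G.dil r⁻¹ := by
      change fderiv ℝ (fun x => G.dil r * G.dL (G.dil r⁻¹ x) * G.dil r⁻¹) x x = _
      rw [h2]
      rfl
    have h4 : G.bracket (G.dil r⁻¹ x) * G.dil r⁻¹ = G.dil r⁻¹ * G.bracket x := by
      ext1 v; exact (G.dil_bracket r⁻¹ x v).symm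
    rw [h3, fderiv_dL_apply_self]
    simp only [B]
    calc _ = G.dil r * G.dL (G.dil r⁻¹ x) * (G.bracket (G.dil r⁻¹ x) * G.dil r⁻¹) +
          G.dil r * G.dL (G.dil r⁻¹ x) * G.dil r⁻¹ -
          G.dil r * G.dL (G.dil r⁻¹ x) * 1 * G.dL (G.dil r⁻¹ x) * G.dil r⁻¹ := by
          simp only [mul_add, mul_sub, add_mul, sub_mul, mul_one, _root_.mul_assoc]
      _ = _ := by rw [h4, ← hinv']; simp only [_root_.mul_assoc]
  have hAB : G.dL = B := eq_of_radial_riccati G.bracket hA hB G.dL_zero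
    (by simp only [B, map_zero, dL_zero]; exact hinv) G.fderiv_dL_apply_self hBeq
  have h : G.dL (G.dil r x) (G.dil r v) =
      G.dil r (G.dL (G.dil r⁻¹ (G.dil r x)) (G.dil r⁻¹ (G.dil r v))) :=
    congrArg (fun T => T (G.dil r v)) (congrFun hAB (G.dil r x))
  rw [G.dil_inv_dil hr, G.dil_inv_dil hr] at h
  exact h.symm

/-! ### Left invariance of Lebesgue measure -/

/-- `x ↦ det (G.dL x)` is invariant under dilations and continuous at the origin, so it is `1`. -/
theorem det_dL (x : RSpace N) : (G.dL x).det = 1 := by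
  have hdet : ∀ r : ℝ, r ≠ 0 → (G.dL (G.dil r x)).det = (G.dL x).det := by
    intro r hr
    let e : RSpace N ≃ₗ[ℝ] RSpace N := LinearEquiv.ofLinearMap (G.dil r) (G.dil r⁻¹)
      (by ext1 v; exact G.dil_dil_inv hr v) (by ext1 v; exact G.dil_inv_dil hr v)
    have : (G.dL (G.dil r x) : RSpace N →ₗ[ℝ] RSpace N) =
        (e : RSpace N →ₗ[ℝ] RSpace N) ∘ₗ (G.dL x : RSpace N →ₗ[ℝ] RSpace N) ∘ₗ
          (e.symm : RSpace N →ₗ[ℝ] RSpace N) := by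
      ext1 v
      have := G.dil_dL r hr x (G.dil r⁻¹ v)
      rw [G.dil_dil_inv hr] at this
      exact this.symm
    rw [ContinuousLinearMap.det, this]
    exact LinearMap.det_conj _ e
  have hcont : Continuous fun r : ℝ => (G.dL (G.dil r x)).det := by
    have h1 : Continuous fun r : ℝ => G.dil r x := by
      refine (PiLp.continuous_toLp 2 _).comp ?_
      fun_prop
    exact ContinuousLinearMap.continuous_det.comp (G.contDiff_dL.continuous.comp h1)
  have h0 : G.dil 0 x = 0 := by
    ext j; simp [Nat.one_le_iff_ne_zero.1 (G.one_le_deg j)]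
  have hlim : Tendsto (fun r : ℝ => (G.dL (G.dil r x)).det) (𝓝[≠] 0) (𝓝 1) := by
    have := hcont.tendsto 0
    simp only [h0, dL_zero] at this
    rw [show (ContinuousLinearMap.id ℝ (RSpace N)).det = 1 from LinearMap.det_id] at this
    exact this.mono_left nhdsWithin_le_nhds
  have hlim' : Tendsto (fun r : ℝ => (G.dL (G.dil r x)).det) (𝓝[≠] 0) (𝓝 (G.dL x).det) := by
    refine tendsto_const_nhds.congr' ?_
    filter_upwards [self_mem_nhdsWithin] with r hr using (hdet r hr).symm
  exact tendsto_nhds_unique hlim' hlim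

theorem det_fderiv_mul_left (a x : RSpace N) : (fderiv ℝ (G.mul a) x).det = 1 := by
  have h := congrArg ContinuousLinearMap.det (G.fderiv_mul_left_comp_dL a x)
  have h2 : ((fderiv ℝ (G.mul a) x).comp (G.dL x)).det =
      (fderiv ℝ (G.mul a) x).det * (G.dL x).det := LinearMap.det_comp _ _
  rwa [h2, det_dL, det_dL, mul_one] at h

/-- Lebesgue measure is left invariant. -/
theorem measurePreserving_mul_left (a : RSpace N) :
    MeasurePreserving (G.mul a) volume volume := by
  refine ⟨(G.contDiff_mul_left a).continuous.measurable, ?_⟩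
  ext S hS
  rw [Measure.map_apply (G.contDiff_mul_left a).continuous.measurable hS]
  have himg : G.mul a ⁻¹' S = G.mul (G.inv a) '' S := by
    ext x
    constructor
    · intro h
      exact ⟨_, h, G.inv_mul_cancel_left a x⟩
    · rintro ⟨y, hy, rfl⟩
      simpa [G.mul_inv_cancel_left] using hy
  rw [himg, ← lintegral_abs_det_fderiv_eq_addHaar_image volume hS
    (fun x _ =>
      ((G.contDiff_mul_left (G.inv a)).differentiable (by simp) x).hasFDerivAt.hasFDerivWithinAt)
    (fun x _ y _ h => by
      simpa [G.mul_inv_cancel_left] using congrArg (G.mul a) h)]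
  simp [det_fderiv_mul_left]

/-! ### Invariance and homogeneity of the distance -/

/-- The lengths of the horizontal curves from `x` to `y`. -/
def lengths (x y : RSpace N) : Set ℝ :=
  {L : ℝ | ∃ (γ : ℝ → RSpace N) (u : ℝ → EuclideanSpace ℝ G.HIndex),
    G.IsHorizontal γ u 0 1 ∧ γ 0 = x ∧ γ 1 = y ∧ L = ∫ t in (0 : ℝ)..1, ‖u t‖}

theorem ccDist_eq_sInf_lengths (x y : RSpace N) : G.ccDist x y = sInf (G.lengths x y) := rfl

theorem ccDist_nonneg (x y : RSpace N) : 0 ≤ G.ccDist x y := by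
  refine Real.sInf_nonneg ?_
  rintro _ ⟨γ, u, -, -, -, rfl⟩
  exact intervalIntegral.integral_nonneg zero_le_one fun _ _ => norm_nonneg _

/-- A `C¹` map that multiplies the horizontal frame by `c` multiplies lengths by `c`. -/
theorem mul_mem_lengths {φ : RSpace N → RSpace N} (hφ : ContDiff ℝ 1 φ) {c : ℝ} (hc : 0 ≤ c)
    (hX : ∀ (j : G.HIndex) x, fderiv ℝ φ x (G.X j x) = c • G.X j (φ x))
    {x y : RSpace N} {L : ℝ} (hL : L ∈ G.lengths x y) : c * L ∈ G.lengths (φ x) (φ y) := by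
  obtain ⟨γ, u, ⟨hac, hu, hd⟩, rfl, rfl, rfl⟩ := hL
  refine ⟨fun t => φ (γ t), fun t => c • u t, ⟨hac.comp_contDiff zero_le_one hφ,
    fun j => (hu j).const_mul c, ?_⟩, rfl, rfl, ?_⟩
  · filter_upwards [hac.1, hd] with t ht htd
    have h1 : HasDerivAt (fun t => φ (γ t)) (fderiv ℝ φ (γ t) (deriv γ t)) t :=
      ((hφ.differentiable one_ne_zero (γ t)).hasFDerivAt).comp_hasDerivAt t ht.hasDerivAt
    rw [h1.deriv, htd, map_sum]
    refine Finset.sum_congr rfl fun j _ => ?_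
    rw [map_smul, hX, smul_smul, mul_comm]
    rfl
  · rw [← intervalIntegral.integral_const_mul]
    simp only [norm_smul, Real.norm_of_nonneg hc]

open scoped Pointwise in
/-- A `C¹` diffeomorphism that multiplies the horizontal frame by `c > 0` multiplies the distance
by `c`. The sets of lengths themselves correspond, so this does not require that the points can be
joined by a horizontal curve. -/
theorem ccDist_map {φ ψ : RSpace N → RSpace N} (hφ : ContDiff ℝ 1 φ) (hψ : ContDiff ℝ 1 ψ)
    (hψφ : ∀ x, ψ (φ x) = x) {c : ℝ} (hc : 0 < c)
    (hX : ∀ (j : G.HIndex) x, fderiv ℝ φ x (G.X j x) = c • G.X j (φ x))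
    (hX' : ∀ (j : G.HIndex) x, fderiv ℝ ψ x (G.X j x) = c⁻¹ • G.X j (ψ x)) (x y : RSpace N) :
    G.ccDist (φ x) (φ y) = c * G.ccDist x y := by
  have h : G.lengths (φ x) (φ y) = c • G.lengths x y := by
    ext L
    rw [mem_smul_set_iff_inv_smul_mem₀ hc.ne', smul_eq_mul]
    constructor
    · intro hL
      simpa only [hψφ] using G.mul_mem_lengths hψ (inv_nonneg.2 hc.le) hX' hL
    · intro hL
      have := G.mul_mem_lengths hφ hc.le hX hL
      rwa [mul_inv_cancel_left₀ hc.ne'] at this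
  rw [ccDist_eq_sInf_lengths, h, Real.sInf_smul_of_nonneg hc.le]
  rfl

theorem fderiv_mul_left_X (a : RSpace N) (j : Fin N) (x : RSpace N) :
    fderiv ℝ (G.mul a) x (G.X j x) = G.X j (G.mul a x) :=
  congrArg (fun T => T (EuclideanSpace.single j 1)) (G.fderiv_mul_left_comp_dL a x)

theorem ccDist_mul_left (a x y : RSpace N) :
    G.ccDist (G.mul a x) (G.mul a y) = G.ccDist x y := by
  have h := G.ccDist_map (φ := G.mul a) (ψ := G.mul (G.inv a)) (c := 1)
    ((G.contDiff_mul_left a).of_le (by simp)) ((G.contDiff_mul_left _).of_le (by simp))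
    (G.inv_mul_cancel_left a) one_pos
    (fun j x => by rw [fderiv_mul_left_X, one_smul])
    (fun j x => by rw [fderiv_mul_left_X, inv_one, one_smul]) x y
  rwa [one_mul] at h

theorem fderiv_dil_X {r : ℝ} (hr : r ≠ 0) (j : G.HIndex) (x : RSpace N) :
    fderiv ℝ (G.dil r) x (G.X j x) = r • G.X j (G.dil r x) := by
  rw [ContinuousLinearMap.fderiv, X_eq_dL, G.dil_dL r hr,
    G.dil_of_mem_degSubspace r (single_mem_degSubspace G.deg (j : Fin N) 1), j.2, pow_one, map_smul]

theorem ccDist_dil {r : ℝ} (hr : 0 < r) (x y : RSpace N) :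
    G.ccDist (G.dil r x) (G.dil r y) = r * G.ccDist x y :=
  G.ccDist_map (ψ := G.dil r⁻¹) (G.dil r).contDiff (G.dil r⁻¹).contDiff (G.dil_inv_dil hr.ne') hr
    (G.fderiv_dil_X hr.ne') (G.fderiv_dil_X (inv_ne_zero hr.ne')) x y

/-- Reversing time keeps the length of a horizontal curve. -/
theorem mem_lengths_symm {x y : RSpace N} {L : ℝ} (hL : L ∈ G.lengths x y) :
    L ∈ G.lengths y x := by
  obtain ⟨γ, u, ⟨⟨hd, hi, hf⟩, hu, hγ⟩, rfl, rfl, rfl⟩ := hL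
  have hqmp : Measure.QuasiMeasurePreserving (fun t : ℝ => 1 - t)
      (volume.restrict (Icc 0 1)) (volume.restrict (Icc 0 1)) := by
    have := (Measure.measurePreserving_sub_left (volume : Measure ℝ) 1).restrict_preimage
      (measurableSet_Icc (a := (0 : ℝ)) (b := 1))
    have he : (fun t : ℝ => 1 - t) ⁻¹' Icc 0 1 = Icc 0 1 := by simp
    rw [he] at this
    exact this.quasiMeasurePreserving
  have hderiv : deriv (fun t => γ (1 - t)) = fun t => -deriv γ (1 - t) :=
    funext fun t => deriv_comp_const_sub γ 1 t
  refine ⟨fun t => γ (1 - t), fun t => -u (1 - t), ⟨⟨?_, ?_, ?_⟩, ?_, ?_⟩, by simp, by simp, ?_⟩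
  · filter_upwards [hqmp.ae hd] with t ht
    exact ht.comp t ((differentiableAt_const 1).sub differentiableAt_id)
  · rw [hderiv]
    have h := (hi.comp_sub_left 1).symm.neg
    rw [sub_zero, sub_self] at h
    exact h
  · intro t₁ h₁ t₂ h₂
    rw [hderiv, intervalIntegral.integral_neg,
      intervalIntegral.integral_comp_sub_left (fun t => deriv γ t),
      ← intervalIntegral.integral_symm]
    exact hf _ ⟨by linarith [h₁.2], by linarith [h₁.1]⟩ _ ⟨by linarith [h₂.2], by linarith [h₂.1]⟩
  · intro j
    have h := ((hu j).comp_sub_left 1).symm.neg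
    rw [sub_zero, sub_self] at h
    exact h
  · filter_upwards [hqmp.ae hγ] with t ht
    rw [hderiv]
    simp [ht]
  · simp only [norm_neg]
    rw [intervalIntegral.integral_comp_sub_left (fun t => ‖u t‖)]
    simp

theorem ccDist_comm (x y : RSpace N) : G.ccDist x y = G.ccDist y x := by
  have : G.lengths x y = G.lengths y x :=
    Subset.antisymm (fun _ h => G.mem_lengths_symm h) fun _ h => G.mem_lengths_symm h
  rw [ccDist_eq_sInf_lengths, this, ccDist_eq_sInf_lengths]

/-! ### Blowing up at a point -/

theorem det_dil (r : ℝ) : (G.dil r).det = ∏ j, r ^ G.deg j := by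
  rw [ContinuousLinearMap.det, ← LinearMap.det_toMatrix (EuclideanSpace.basisFun (Fin N) ℝ).toBasis]
  have : LinearMap.toMatrix (EuclideanSpace.basisFun (Fin N) ℝ).toBasis
      (EuclideanSpace.basisFun (Fin N) ℝ).toBasis (G.dil r : RSpace N →ₗ[ℝ] RSpace N) =
      Matrix.diagonal fun j => r ^ G.deg j := by
    ext i j
    rw [LinearMap.toMatrix_apply]
    by_cases h : i = j
    · subst h; simp
    · simp [h]
  rw [this, Matrix.det_diagonal]

/-- The map `z ↦ x₀ · δ_r z`, which takes the unit ball at the origin to the ball `B(x₀, r)`. -/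
noncomputable def blowUp (x₀ : RSpace N) (r : ℝ) (z : RSpace N) : RSpace N :=
  G.mul x₀ (G.dil r z)

theorem inv_mul_blowUp (x₀ : RSpace N) (r : ℝ) (z : RSpace N) :
    G.mul (G.inv x₀) (G.blowUp x₀ r z) = G.dil r z := G.inv_mul_cancel_left _ _

theorem ccDist_blowUp (x₀ : RSpace N) {r : ℝ} (hr : 0 < r) (z : RSpace N) :
    G.ccDist x₀ (G.blowUp x₀ r z) = r * G.ccDist 0 z := by
  have h := G.ccDist_mul_left x₀ 0 (G.dil r z)
  rw [G.mul_zero] at h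
  have h' := G.ccDist_dil hr 0 z
  rw [map_zero] at h'
  rw [blowUp, h, h']

theorem blowUp_surjective (x₀ : RSpace N) {r : ℝ} (hr : r ≠ 0) :
    Function.Surjective (G.blowUp x₀ r) := fun x =>
  ⟨G.dil r⁻¹ (G.mul (G.inv x₀) x), by
    rw [blowUp, G.dil_dil_inv hr, G.mul_inv_cancel_left]⟩

theorem volume_image_blowUp (x₀ : RSpace N) (r : ℝ) (E : Set (RSpace N)) :
    volume (G.blowUp x₀ r '' E) = ENNReal.ofReal |(G.dil r).det| * volume E := by
  let e : RSpace N ≃ₜ RSpace N :=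
    { toFun := G.mul (G.inv x₀)
      invFun := G.mul x₀
      left_inv := G.mul_inv_cancel_left x₀
      right_inv := G.inv_mul_cancel_left x₀
      continuous_toFun := (G.contDiff_mul_left _).continuous
      continuous_invFun := (G.contDiff_mul_left _).continuous }
  have h1 : G.blowUp x₀ r '' E = e ⁻¹' (G.dil r '' E) := by
    rw [← e.image_symm, image_image]; rfl
  have h2 : MeasurePreserving e volume volume := G.measurePreserving_mul_left _
  rw [h1, h2.measure_preimage_emb e.measurableEmbedding,
    Measure.addHaar_image_continuousLinearMap]

theorem det_dil_pos {r : ℝ} (hr : 0 < r) : 0 < (G.dil r).det := by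
  rw [det_dil]; exact Finset.prod_pos fun _ _ => pow_pos hr _

theorem quasiMeasurePreserving_blowUp (x₀ : RSpace N) {r : ℝ} (hr : 0 < r) :
    Measure.QuasiMeasurePreserving (G.blowUp x₀ r) volume volume :=
  (G.measurePreserving_mul_left x₀).quasiMeasurePreserving.comp
    (Measure.LinearMap.quasiMeasurePreserving volume (G.dil r : RSpace N →ₗ[ℝ] RSpace N)
      (G.det_dil_pos hr).ne')

theorem ccBall_inter (x₀ : RSpace N) {r : ℝ} (hr : 0 < r) (E : Set (RSpace N)) :
    G.ccBall x₀ r ∩ E = G.blowUp x₀ r '' (G.ccBall 0 1 ∩ G.blowUp x₀ r ⁻¹' E) := by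
  rw [image_inter_preimage]
  congr 1
  have : G.ccBall 0 1 = G.blowUp x₀ r ⁻¹' G.ccBall x₀ r := by
    ext z
    simp only [ccBall, mem_ofPred_eq, mem_preimage, G.ccDist_blowUp x₀ hr]
    rw [mul_lt_iff_lt_one_right hr]
  rw [this, image_preimage_eq _ (G.blowUp_surjective x₀ hr.ne')]

/-- Density one at `x₀`, read on the unit ball at the origin after blowing up. -/
theorem hasDensityOne_iff (x₀ : RSpace N) (E : Set (RSpace N)) :
    G.HasDensityOne E x₀ ↔ Tendsto (fun r : ℝ =>
      volume (G.ccBall 0 1 ∩ G.blowUp x₀ r ⁻¹' E) / volume (G.ccBall 0 1)) (𝓝[>] 0) (𝓝 1) := by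
  refine tendsto_congr' ?_
  filter_upwards [self_mem_nhdsWithin] with r hr
  have hr' : (0 : ℝ) < r := hr
  have h := G.ccBall_inter x₀ hr' univ
  rw [inter_univ, preimage_univ, inter_univ] at h
  rw [G.ccBall_inter x₀ hr' E, h, volume_image_blowUp, volume_image_blowUp]
  exact ENNReal.mul_div_mul_left _ _ (by simpa using (G.det_dil_pos hr').ne') ENNReal.ofReal_ne_top

/-- A ratio `0 / 0` or `a / ∞` is `0`, so the existence of a set of density one records that the
unit ball has positive finite measure. -/
theorem volume_ccBall_of_hasDensityOne {x₀ : RSpace N} {E : Set (RSpace N)}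
    (h : G.HasDensityOne E x₀) : volume (G.ccBall 0 1) ≠ 0 ∧ volume (G.ccBall 0 1) ≠ ⊤ := by
  rw [hasDensityOne_iff] at h
  obtain ⟨r, hr⟩ := (h.eventually_ne one_ne_zero).exists
  refine ⟨fun h0 => hr ?_, fun ht => hr ?_⟩
  · rw [measure_mono_null inter_subset_left h0, ENNReal.zero_div]
  · rw [ht, ENNReal.div_top]

/-- The points at distance zero from the origin form a dilation invariant set contained in the
unit ball, so this set is null as soon as the ball has finite measure. -/
theorem volume_ccDist_eq_zero (hN : 0 < N) (hfin : volume (G.ccBall 0 1) ≠ ⊤) :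
    volume {z : RSpace N | G.ccDist 0 z = 0} = 0 := by
  set Z := {z : RSpace N | G.ccDist 0 z = 0}
  have hZ : volume Z ≠ ⊤ := measure_ne_top_of_subset
    (fun z (hz : _ = _) => by rw [ccBall, mem_ofPred_eq, hz]; exact one_pos) hfin
  have himg : G.blowUp 0 2 '' Z = Z := by
    have : Z = G.blowUp 0 2 ⁻¹' Z := by
      ext z
      simp [Z, G.ccDist_blowUp 0 two_pos]
    conv_lhs => rw [this]
    exact image_preimage_eq _ (G.blowUp_surjective 0 two_ne_zero)
  -- here `0 < N` is needed
  have hdet : 1 < (G.dil 2).det := by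
    rw [det_dil]
    refine Finset.prod_induction_nonempty _ (fun a : ℝ => 1 < a)
      (fun a b ha hb => one_lt_mul ha.le hb) ?_ ?_
    · exact ⟨⟨0, hN⟩, Finset.mem_univ _⟩
    · exact fun j _ => one_lt_pow₀ one_lt_two (Nat.one_le_iff_ne_zero.1 (G.one_le_deg j))
  have hvol := G.volume_image_blowUp 0 2 Z
  rw [himg] at hvol
  by_contra h0
  have h1 : ENNReal.ofReal |(G.dil 2).det| = 1 := by
    rw [← ENNReal.mul_left_inj h0 hZ, one_mul, ← hvol]
  rw [ENNReal.ofReal_eq_one, abs_of_pos (by linarith)] at h1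
  linarith

end CarnotGroup

/-! ### Convergence in measure -/

/-- If the sets `E r` fill `S` asymptotically in outer measure and are contained in measurable
sets `M r` up to null sets, then `S \ M r` becomes small. Neither `S` nor `E r` has to be
measurable: only `M r` is used to split `S`. -/
theorem tendsto_measure_diff_of_tendsto_ratio {Ω ι : Type*} [MeasurableSpace Ω] {μ : Measure Ω}
    {S : Set Ω} (h0 : μ S ≠ 0) (htop : μ S ≠ ⊤) {l : Filter ι} {E M : ι → Set Ω}
    (hE : Tendsto (fun r => μ (S ∩ E r) / μ S) l (𝓝 1))
    (hM : ∀ᶠ r in l, NullMeasurableSet (M r) μ) (hEM : ∀ᶠ r in l, μ ((S ∩ E r) \ M r) = 0) :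
    Tendsto (fun r => μ (S \ M r)) l (𝓝 0) := by
  have h1 : Tendsto (fun r => μ S - μ (S ∩ E r)) l (𝓝 0) := by
    have h2 : Tendsto (fun r => μ (S ∩ E r)) l (𝓝 (μ S)) := by
      have := ENNReal.Tendsto.mul_const (b := μ S) hE (Or.inl one_ne_zero)
      rw [one_mul] at this
      exact this.congr fun r => ENNReal.div_mul_cancel h0 htop
    have := ENNReal.Tendsto.sub (tendsto_const_nhds (x := μ S)) h2 (Or.inl htop)
    rwa [tsub_self] at this
  refine tendsto_of_tendsto_of_tendsto_of_le_of_le' tendsto_const_nhds h1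
    (Eventually.of_forall fun _ => zero_le) ?_
  filter_upwards [hM, hEM] with r hMr hEMr
  -- outer measure is subadditive, and what `M r` misses of `S ∩ E r` is null
  have hle : μ (S ∩ E r) ≤ μ (S ∩ M r) := by
    have hsub : S ∩ E r ⊆ (S ∩ M r) ∪ ((S ∩ E r) \ M r) := fun z hz => by
      by_cases hzM : z ∈ M r
      · exact Or.inl ⟨hz.1, hzM⟩
      · exact Or.inr ⟨hz, hzM⟩
    calc _ ≤ μ (S ∩ M r) + μ ((S ∩ E r) \ M r) := (measure_mono hsub).trans (measure_union_le _ _)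
      _ = _ := by rw [hEMr, add_zero]
  have hadd := measure_inter_add_sdiff₀ S hMr
  refine ENNReal.le_sub_of_add_le_left
    (ne_top_of_le_ne_top htop (measure_mono inter_subset_left)) ?_
  rw [← hadd]
  gcongr

/-- If outside small parts of `S` the function `F_r` is bounded by `ε`, for every `ε > 0`, and
`F_r → Q` pointwise, then `Q = 0` almost everywhere on `S`. No measurability is needed. -/
theorem measure_ne_zero_eq_zero_of_tendsto {Ω : Type*} [MeasurableSpace Ω] {μ : Measure Ω}
    {S : Set Ω} {F : ℝ → Ω → ℝ} {Q : Ω → ℝ}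
    (hF : ∀ ε : ℝ, 0 < ε → Tendsto (fun r => μ (S \ {z | |F r z| ≤ ε})) (𝓝[>] 0) (𝓝 0))
    (hQ : ∀ z, Tendsto (fun r => F r z) (𝓝[>] 0) (𝓝 (Q z))) :
    μ (S ∩ {z | Q z ≠ 0}) = 0 := by
  obtain ⟨u, -, hu0, hu⟩ := exists_seq_strictAnti_tendsto (0 : ℝ)
  have hu' : Tendsto u atTop (𝓝[>] 0) :=
    tendsto_nhdsWithin_iff.2 ⟨hu, Eventually.of_forall hu0⟩
  have hnull : ∀ ε : ℝ, 0 < ε → μ {z ∈ S | ε < |Q z|} = 0 := by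
    intro ε hε
    -- a point where `|Q| > ε` lies in all but finitely many of the exceptional sets
    refine measure_mono_null (t := ⋃ n, ⋂ m ≥ n, S \ {z | |F (u m) z| ≤ ε}) ?_ ?_
    · rintro z ⟨hzS, hz⟩
      have := ((hQ z).comp hu').abs.eventually (lt_mem_nhds hz)
      obtain ⟨n, hn⟩ := eventually_atTop.1 this
      exact mem_iUnion.2 ⟨n, mem_iInter₂.2 fun m hm => ⟨hzS, not_le.2 (hn m hm)⟩⟩
    · refine measure_iUnion_null fun n => le_antisymm ?_ zero_le
      refine ge_of_tendsto ((hF ε hε).comp hu') ?_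
      filter_upwards [eventually_ge_atTop n] with m hm
      exact measure_mono (iInter₂_subset m hm)
  refine measure_mono_null (t := ⋃ n : ℕ, {z ∈ S | 1 / ((n : ℝ) + 1) < |Q z|}) ?_
    (measure_iUnion_null fun n => hnull _ Nat.one_div_pos_of_nat)
  rintro z ⟨hzS, hz⟩
  obtain ⟨n, hn⟩ := exists_nat_one_div_lt (abs_pos.2 hz)
  exact mem_iUnion.2 ⟨n, hzS, hn⟩

namespace CarnotGroup

variable {N s : ℕ} (G : CarnotGroup N s)

/-! ### Homogeneous polynomials -/

/-- The normalized monomial `z^J / J!`. -/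
noncomputable def normMonomial (J : Fin N → ℕ) (z : RSpace N) : ℝ :=
  (∏ j, z j ^ J j) / ((∏ j, (J j).factorial : ℕ) : ℝ)

theorem normMonomial_dil (r : ℝ) (J : Fin N → ℕ) (z : RSpace N) :
    normMonomial J (G.dil r z) = r ^ G.hnorm J * normMonomial J z := by
  simp only [normMonomial, dil_apply, mul_pow, Finset.prod_mul_distrib, hnorm, ← pow_mul,
    Finset.prod_pow_eq_pow_sum, mul_div_assoc]

theorem volume_sum_normMonomial_eq_zero (I : Finset (Fin N → ℕ)) (c : (Fin N → ℕ) → ℝ)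
    {J₀ : Fin N → ℕ} (hJ₀ : J₀ ∈ I) (hc : c J₀ ≠ 0) :
    volume {z : RSpace N | ∑ J ∈ I, c J * normMonomial J z = 0} = 0 := by
  let p : MvPolynomial (Fin N) ℝ := ∑ J ∈ I, MvPolynomial.monomial
    (Finsupp.equivFunOnFinite.symm J) (c J / ((∏ j, (J j).factorial : ℕ) : ℝ))
  have hp : p ≠ 0 := by
    intro h
    have h1 := congrArg (MvPolynomial.coeff (Finsupp.equivFunOnFinite.symm J₀)) h
    simp only [p, MvPolynomial.coeff_sum, MvPolynomial.coeff_monomial, MvPolynomial.coeff_zero,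
      EmbeddingLike.apply_eq_iff_eq, Finset.sum_ite_eq', hJ₀, if_true] at h1
    refine div_ne_zero hc ?_ h1
    exact Nat.cast_ne_zero.2 (Finset.prod_ne_zero_iff.2 fun j _ => Nat.factorial_ne_zero _)
  refine measure_mono_null (fun z hz => ?_) (MvPolynomial.volume_zeroSet_eq_zero hp)
  rw [mem_ofPred_eq] at hz ⊢
  rw [← hz, map_sum]
  refine Finset.sum_congr rfl fun J _ => ?_
  rw [MvPolynomial.eval_monomial, Finsupp.prod_fintype _ _ fun _ => pow_zero _, normMonomial]
  simp only [Finsupp.equivFunOnFinite_symm_apply_apply]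
  ring

/-- A polynomial of homogeneous degree at most `m` which is `o(r ^ m)` in measure on the dilates
of a set of positive measure vanishes: by induction on `h`, its part of degree `h` is the pointwise
limit of the rescaled polynomial, hence zero almost everywhere on that set. -/
theorem coeff_eq_zero_of_tendsto {S : Set (RSpace N)} (hS : volume S ≠ 0) (m : ℕ)
    (c : (Fin N → ℕ) → ℝ)
    (h : ∀ ε : ℝ, 0 < ε → Tendsto (fun r : ℝ => volume (S \ {z |
      |∑ J ∈ G.multiIndices m, c J * normMonomial J (G.dil r z)| ≤ ε * r ^ m})) (𝓝[>] 0) (𝓝 0)) :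
    ∀ J, G.hnorm J ≤ m → c J = 0 := by
  suffices H : ∀ d J, G.hnorm J = d → d ≤ m → c J = 0 from fun J hJ => H _ J rfl hJ
  intro d
  induction d using Nat.strong_induction_on with
  | _ d ih =>
  intro J₀ hJ₀ hd
  by_contra hc
  set I := (G.multiIndices m).filter fun J => G.hnorm J = d with hI
  -- the polynomial on the dilate, divided by `r ^ d`; the truncated subtraction only affects terms
  -- whose coefficient is already known to vanish
  let F : ℝ → RSpace N → ℝ := fun r z =>
    ∑ J ∈ G.multiIndices m, c J * (r ^ (G.hnorm J - d) * normMonomial J z)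
  have hF : ∀ r z, ∑ J ∈ G.multiIndices m, c J * normMonomial J (G.dil r z) = r ^ d * F r z := by
    intro r z
    rw [Finset.mul_sum]
    refine Finset.sum_congr rfl fun J _ => ?_
    rcases lt_or_ge (G.hnorm J) d with hlt | hge
    · rw [ih _ hlt J rfl (hlt.le.trans hd)]; ring
    · rw [normMonomial_dil, ← Nat.sub_add_cancel hge, pow_add, Nat.sub_add_cancel hge]; ring
  have hlim : ∀ z, Tendsto (fun r => F r z) (𝓝[>] 0) (𝓝 (∑ J ∈ I, c J * normMonomial J z)) := by
    intro z
    have h0 : F 0 z = ∑ J ∈ I, c J * normMonomial J z := by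
      rw [hI, Finset.sum_filter]
      refine Finset.sum_congr rfl fun J _ => ?_
      split_ifs with hJ
      · simp [hJ]
      · rcases lt_or_gt_of_ne hJ with hlt | hgt
        · rw [ih _ hlt J rfl (hlt.le.trans hd)]; ring
        · simp [(Nat.sub_pos_of_lt hgt).ne']
    rw [← h0]
    have : Continuous fun r => F r z := by fun_prop
    exact (this.tendsto 0).mono_left nhdsWithin_le_nhds
  have hnull := measure_ne_zero_eq_zero_of_tendsto (μ := volume) (S := S) ?_ hlim
  · refine hS (measure_mono_null (fun z hz => ?_) (measure_union_null hnull
      (volume_sum_normMonomial_eq_zero I c (J₀ := J₀) ?_ hc)))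
    · by_cases hz0 : ∑ J ∈ I, c J * normMonomial J z = 0
      · exact Or.inr hz0
      · exact Or.inl ⟨hz, hz0⟩
    · exact Finset.mem_filter.2 ⟨(G.mem_multiIndices m J₀).2 (hJ₀.le.trans hd), hJ₀⟩
  · intro ε hε
    refine tendsto_of_tendsto_of_tendsto_of_le_of_le' tendsto_const_nhds (h ε hε)
      (Eventually.of_forall fun _ => zero_le) ?_
    filter_upwards [Ioc_mem_nhdsGT one_pos] with r hr
    refine measure_mono (sdiff_subset_sdiff_right fun z hz => ?_)
    rw [mem_ofPred_eq, hF, abs_mul, abs_of_pos (pow_pos hr.1 d)] at hz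
    have hrd := pow_pos hr.1 d
    -- `r ≤ 1` and `d ≤ m`
    have hpow : r ^ m ≤ r ^ d := pow_le_pow_of_le_one hr.1.le hr.2 hd
    rw [mem_ofPred_eq]
    nlinarith

/-! ### Uniqueness of approximate polynomials -/

theorem centredPoly_eq_sum (x₀ : RSpace N) (k : ℕ) (α : (Fin N → ℕ) → ℝ) (x : RSpace N) :
    G.centredPoly x₀ k α x =
      ∑ J ∈ G.multiIndices k, α J * normMonomial J (G.mul (G.inv x₀) x) := rfl

theorem continuous_centredPoly (x₀ : RSpace N) (k : ℕ) (α : (Fin N → ℕ) → ℝ) :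
    Continuous (G.centredPoly x₀ k α) := by
  have h : Continuous (G.mul (G.inv x₀)) := (G.contDiff_mul_left _).continuous
  unfold centredPoly
  fun_prop

/-- Approximation of order `o(d(x, x₀) ^ m)` in measure near `x₀`, read on the unit ball after
blowing up: the part of the unit ball where `|f - p| ≤ ε r ^ m` fails at points of `D` is small. -/
def IsBlowUpApprox (D : Set (RSpace N)) (f p : RSpace N → ℝ) (x₀ : RSpace N) (m : ℕ) : Prop :=
  ∀ ε : ℝ, 0 < ε → Tendsto (fun r : ℝ => volume (G.ccBall 0 1 \
    G.blowUp x₀ r ⁻¹' {x | x ∈ D → |f x - p x| ≤ ε * r ^ m})) (𝓝[>] 0) (𝓝 0)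

variable {D : Set (RSpace N)} {f : RSpace N → ℝ} {x₀ : RSpace N}

/-- The balls and the distance are not assumed measurable. The bounds `|f - p| ≤ c d ^ k` are
therefore first replaced by the bounds `|f - p| ≤ ε r ^ m`, which define measurable sets; a set
that contains almost all of the ball in outer measure then has a complement of small measure. -/
theorem isBlowUpApprox_of_hasDensityOne (hN : 0 < N) (hD : NullMeasurableSet D volume)
    (hf : AEMeasurable f (volume.restrict D)) (hdens : G.HasDensityOne D x₀)
    {p : RSpace N → ℝ} (hp : Continuous p) {m : ℕ}
    (h : ∀ ε : ℝ, 0 < ε → ∃ E : Set (RSpace N), G.HasDensityOne E x₀ ∧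
      ∀ᶠ r : ℝ in 𝓝[>] 0, ∀ x ∈ E, x ∈ D → 0 < G.ccDist x x₀ → G.ccDist x x₀ < r →
        |f x - p x| ≤ ε * r ^ m) :
    G.IsBlowUpApprox D f p x₀ m := by
  obtain ⟨hS0, hStop⟩ := G.volume_ccBall_of_hasDensityOne hdens
  intro ε hε
  obtain ⟨E, hE, hEr⟩ := h ε hε
  refine tendsto_measure_diff_of_tendsto_ratio hS0 hStop ((G.hasDensityOne_iff x₀ E).1 hE) ?_ ?_
  · filter_upwards [self_mem_nhdsWithin] with r hr
    refine NullMeasurableSet.preimage ?_ (G.quasiMeasurePreserving_blowUp x₀ hr)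
    have hg : AEMeasurable (fun x => |f x - p x|) (volume.restrict D) :=
      measurable_norm.comp_aemeasurable (hf.sub hp.measurable.aemeasurable)
    have h1 := (nullMeasurableSet_restrict (t := {x | |f x - p x| ≤ ε * r ^ m}) hD).1
      (hg.nullMeasurable measurableSet_Iic)
    have h2 : {x | x ∈ D → |f x - p x| ≤ ε * r ^ m} =
        ({x | |f x - p x| ≤ ε * r ^ m} ∩ D) ∪ Dᶜ := by
      ext x
      by_cases hx : x ∈ D <;> simp [hx]
    rw [h2]
    exact h1.union hD.compl
  · filter_upwards [hEr, self_mem_nhdsWithin] with r hr hr0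
    have hr0' : (0 : ℝ) < r := hr0
    refine measure_mono_null (fun z hz => ?_) (G.volume_ccDist_eq_zero hN hStop)
    obtain ⟨⟨hzS, hzE⟩, hzM⟩ := hz
    -- at points at distance zero the bound on `f - p` is not available; they form a null set
    by_contra hz0
    have hpos : 0 < G.ccDist 0 z := lt_of_le_of_ne (G.ccDist_nonneg 0 z) (Ne.symm hz0)
    have hdist : G.ccDist (G.blowUp x₀ r z) x₀ = r * G.ccDist 0 z := by
      rw [G.ccDist_comm, G.ccDist_blowUp x₀ hr0']
    refine hzM fun hzD => hr _ hzE hzD ?_ ?_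
    · rw [hdist]; positivity
    · rw [hdist]; exact mul_lt_of_lt_one_right hr0' hzS

theorem coeff_eq_of_isBlowUpApprox (hD : NullMeasurableSet D volume)
    (hdens : G.HasDensityOne D x₀) {m : ℕ} {α β : (Fin N → ℕ) → ℝ}
    (hα : G.IsBlowUpApprox D f (G.centredPoly x₀ m α) x₀ m)
    (hβ : G.IsBlowUpApprox D f (G.centredPoly x₀ m β) x₀ m) :
    ∀ J, G.hnorm J ≤ m → α J = β J := by
  obtain ⟨hS0, hStop⟩ := G.volume_ccBall_of_hasDensityOne hdens
  have hDsmall : Tendsto (fun r : ℝ => volume (G.ccBall 0 1 \ G.blowUp x₀ r ⁻¹' D))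
      (𝓝[>] 0) (𝓝 0) := by
    refine tendsto_measure_diff_of_tendsto_ratio hS0 hStop ((G.hasDensityOne_iff x₀ D).1 hdens)
      ?_ (Eventually.of_forall fun r => ?_)
    · filter_upwards [self_mem_nhdsWithin] with r hr
      exact hD.preimage (G.quasiMeasurePreserving_blowUp x₀ hr)
    · rw [sdiff_eq_empty.2 inter_subset_right, measure_empty]
  suffices H : ∀ J, G.hnorm J ≤ m → α J - β J = 0 from fun J hJ => sub_eq_zero.1 (H J hJ)
  refine G.coeff_eq_zero_of_tendsto hS0 m (fun J => α J - β J) fun ε hε => ?_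
  have hsum := (hDsmall.add (hα (ε / 2) (half_pos hε))).add (hβ (ε / 2) (half_pos hε))
  rw [add_zero, add_zero] at hsum
  refine tendsto_of_tendsto_of_tendsto_of_le_of_le tendsto_const_nhds hsum
    (fun _ => zero_le) fun r => ?_
  refine (measure_mono ?_).trans ((measure_union_le _ _).trans
    (add_le_add (measure_union_le _ _) le_rfl))
  rintro z ⟨hzS, hz⟩
  by_contra hcon
  simp only [mem_union, Set.mem_sdiff, hzS, true_and, not_or, not_not, mem_preimage,
    mem_ofPred_eq] at hcon
  obtain ⟨⟨hzD, h1⟩, h2⟩ := hcon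
  have h1 := h1 hzD
  have h2 := h2 hzD
  rw [centredPoly_eq_sum, inv_mul_blowUp] at h1 h2
  refine hz ?_
  simp only [mem_ofPred_eq, sub_mul, Finset.sum_sub_distrib]
  rw [abs_le] at h1 h2 ⊢
  constructor <;> linarith [h1.1, h1.2, h2.1, h2.2]

/-- A bound `|f - p| ≤ l d ^ k` on `B(x₀, r)` gains a factor `l r` over `r ^ (k - 1)`. -/
theorem isBlowUpApprox_of_isApproxTaylor (hN : 0 < N) (hD : NullMeasurableSet D volume)
    (hf : AEMeasurable f (volume.restrict D)) (hdens : G.HasDensityOne D x₀) {k : ℕ} (hk : 1 ≤ k)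
    {α : (Fin N → ℕ) → ℝ} (hα : G.IsApproxTaylor D f x₀ k α) :
    G.IsBlowUpApprox D f (G.centredPoly x₀ (k - 1) α) x₀ (k - 1) := by
  obtain ⟨_, ⟨l, rfl, hl⟩, -⟩ := sInf_lt_iff.1 hα
  refine G.isBlowUpApprox_of_hasDensityOne hN hD hf hdens (G.continuous_centredPoly _ _ _)
    fun ε hε => ⟨_, hl, ?_⟩
  have hlim : Tendsto (fun r : ℝ => |l| * r) (𝓝[>] 0) (𝓝 0) := by
    have : Continuous fun r : ℝ => |l| * r := by fun_prop
    simpa using (this.tendsto 0).mono_left nhdsWithin_le_nhds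
  filter_upwards [hlim.eventually (gt_mem_nhds hε), self_mem_nhdsWithin] with r hr hr0 x hxE hxD
    hpos hlt
  have hr0' : (0 : ℝ) < r := hr0
  have hle : |f x - G.centredPoly x₀ (k - 1) α x| / G.ccDist x x₀ ^ k ≤ l :=
    not_lt.1 fun hlt => hxE ⟨hxD, hlt⟩
  rw [div_le_iff₀ (pow_pos hpos k)] at hle
  calc _ ≤ l * G.ccDist x x₀ ^ k := hle
    _ ≤ |l| * r ^ k := by
      gcongr
      exact le_abs_self l
    _ = |l| * r * r ^ (k - 1) := by
      rw [_root_.mul_assoc, ← pow_succ', Nat.sub_add_cancel hk]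
    _ ≤ ε * r ^ (k - 1) := by gcongr

theorem isBlowUpApprox_of_isApproxDeriv (hN : 0 < N) (hD : NullMeasurableSet D volume)
    (hf : AEMeasurable f (volume.restrict D)) (hdens : G.HasDensityOne D x₀) {k : ℕ}
    {α : (Fin N → ℕ) → ℝ} (hα : G.IsApproxDeriv D f x₀ k α) :
    G.IsBlowUpApprox D f (G.centredPoly x₀ k α) x₀ k := by
  refine G.isBlowUpApprox_of_hasDensityOne hN hD hf hdens (G.continuous_centredPoly _ _ _)
    fun ε hε => ⟨_, hα ε hε, ?_⟩
  filter_upwards [self_mem_nhdsWithin] with r hr0 x hxE hxD hpos hlt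
  have hle := (le_abs_self _).trans hxE.2
  rw [sub_zero, div_le_iff₀ (pow_pos hpos k)] at hle
  exact hle.trans (by gcongr)

theorem centredPoly_congr {k : ℕ} {α β : (Fin N → ℕ) → ℝ}
    (h : ∀ J, G.hnorm J ≤ k → α J = β J) (x₀ x : RSpace N) :
    G.centredPoly x₀ k α x = G.centredPoly x₀ k β x :=
  Finset.sum_congr rfl fun J hJ => by rw [h J ((G.mem_multiIndices k J).1 hJ)]

end CarnotGroup

theorem proposition3p3 {N s : ℕ} (hN : 0 < N) (G : CarnotGroup N s)
    (D : Set (RSpace N)) (hD : NullMeasurableSet D volume)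
    (f : RSpace N → ℝ) (hf : AEMeasurable f (volume.restrict D))
    (x₀ : RSpace N) (hx₀ : x₀ ∈ D) (hdens : G.HasDensityOne D x₀) :
    (∀ k : ℕ, 1 ≤ k → ∀ α β : (Fin N → ℕ) → ℝ,
      G.IsApproxTaylor D f x₀ k α → G.IsApproxTaylor D f x₀ k β →
        (∀ J : Fin N → ℕ, G.hnorm J ≤ k - 1 → α J = β J) ∧
        ∀ x : RSpace N, G.centredPoly x₀ (k - 1) α x = G.centredPoly x₀ (k - 1) β x) ∧
    (∀ k : ℕ, ∀ α β : (Fin N → ℕ) → ℝ,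
      G.IsApproxDeriv D f x₀ k α → G.IsApproxDeriv D f x₀ k β →
        (∀ J : Fin N → ℕ, G.hnorm J ≤ k → α J = β J) ∧
        ∀ x : RSpace N, G.centredPoly x₀ k α x = G.centredPoly x₀ k β x) := by
  refine ⟨fun k hk α β hα hβ => ?_, fun k α β hα hβ => ?_⟩
  · have h := G.coeff_eq_of_isBlowUpApprox hD hdens
      (G.isBlowUpApprox_of_isApproxTaylor hN hD hf hdens hk hα)
      (G.isBlowUpApprox_of_isApproxTaylor hN hD hf hdens hk hβ)
    exact ⟨h, G.centredPoly_congr h x₀⟩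
  · have h := G.coeff_eq_of_isBlowUpApprox hD hdens
      (G.isBlowUpApprox_of_isApproxDeriv hN hD hf hdens hα)
      (G.isBlowUpApprox_of_isApproxDeriv hN hD hf hdens hβ)
    exact ⟨h, G.centredPoly_congr h x₀⟩
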